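/- Let $\mathcal{E}$ be the equation $x+y=3z$. For a positive integer $n$ let $[n]=\{1,\dots,n\}$, let $R_2(\mathcal{E})$ be the least integer $N$ such that every $2$-coloring of $[N]$ contains a monochromatic solution of $\mathcal{E}$, and let $M_{\mathcal{E}}(n)$ be the minimum, over all $2$-colorings of $[n]$, of the number of monochromatic solutions $(x,y,z)\in[n]^3$ of $\mathcal{E}$ (ordered triples, so that $(x,y,z)$ and $(y,x,z)$ with $x\neq y$ count as two solutions, and entries may coincide). Then for every $n\ge R_2(\mathcal{E})$, $$M_{\mathcal{E}}(n)\ \ge\ \frac{167\,n^2}{28800}.$$ -/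

import Mathlib

/-- A three-variable homogeneous linear equation `a x + b y = c z` with integer coefficients. -/
structure LinearEquation where
  a : ℤ
  b : ℤ
  c : ℤ

namespace LinearEquation

/-- `(x, y, z)` is a solution of the equation `a x + b y = c z`. -/
def IsSolution (E : LinearEquation) (x y z : ℕ) : Prop :=
  E.a * (x : ℤ) + E.b * (y : ℤ) = E.c * (z : ℤ)

/-- A `k`-coloring of `[n] = {1, …, n}`. -/
abbrev Coloring (n k : ℕ) : Type := ↥(Finset.Icc 1 n) → Fin k

/-- `(x, y, z)` is a monochromatic solution of `E` in `[n]` under the coloring `χ`. -/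
def IsMonoSolution (E : LinearEquation) {n k : ℕ} (χ : Coloring n k)
    (x y z : ↥(Finset.Icc 1 n)) : Prop :=
  E.IsSolution x y z ∧ χ x = χ y ∧ χ y = χ z

instance (E : LinearEquation) {n k : ℕ} (χ : Coloring n k) (x y z : ↥(Finset.Icc 1 n)) :
    Decidable (E.IsMonoSolution χ x y z) := by
  unfold IsMonoSolution IsSolution
  infer_instance

/-- The number of monochromatic solutions of `E` in `[n]` under `χ`: ordered triples
`(x, y, z)`, so that `(x, y, z)` and `(y, x, z)` with `x ≠ y` are counted separately, and the
entries need not be distinct. -/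
def monoCount (E : LinearEquation) {n k : ℕ} (χ : Coloring n k) : ℕ :=
  (Finset.univ.filter
    fun p : ↥(Finset.Icc 1 n) × ↥(Finset.Icc 1 n) × ↥(Finset.Icc 1 n) =>
      E.IsMonoSolution χ p.1 p.2.1 p.2.2).card

/-- The minimum number of monochromatic solutions of `E` over all `k`-colorings of `[n]`. -/
noncomputable def minMonoCount (E : LinearEquation) (n k : ℕ) : ℕ :=
  ⨅ χ : Coloring n k, E.monoCount χ

/-- The `k`-color Rado number of `E`: the least `N` such that every `k`-coloring of `[N]` has a
monochromatic solution of `E`. -/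
noncomputable def radoNumber (E : LinearEquation) (k : ℕ) : ℕ :=
  sInf {N : ℕ | ∀ χ : Coloring N k, ∃ x y z, E.IsMonoSolution χ x y z}

end LinearEquation

/-- The equation `x + y = 3 z`. -/
def eqXAddYEqThreeZ : LinearEquation := ⟨1, 1, 3⟩

/-! Code the colours as signs `F i = ±1`, with positions counted from 0. Four times the number of
monochromatic solutions is then the number of solutions plus a quadratic form in `F`, so a lower
bound for the count is a lower bound for this form on sign vectors.

For small `n`, adding a suitable diagonal makes the form positive semidefinite. On sign vectors a
diagonal is a constant, which gives an explicit bound (`le_monoPairs_of_psdCheck`).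

For `n = 9 m t`, cut the positions into `3 m` blocks of length `3 t`. The terms `F i * F k`, with
`k` the third entry, sum to `F k` times a sum of `F` over a window. Replacing each window by an
average over its block (`blockSum_mul_le`) leaves a form in the `3 m` block sums whose matrix does
not depend on `t`, so one semidefiniteness check serves every `t`. The terms `F i * F j` depend only
on sums over residue classes mod 3. Together these give `le_monoPairs_of_blockMatrix`, quadratic in
`t`.

Monotonicity in `n` fills the gaps between finitely many small cases and the family `m = 12`. All
matrix checks use exact integer arithmetic. -/

/-! ### A checker for positive semidefiniteness of integer matrices -/

/-- Subtract `⌊a r / b⌋` entrywise from a row. -/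
def reduceRow (b a : ℤ) : List ℤ → List ℤ → List ℤ
  | x :: xs, r :: rs => (x - a * r / b) :: reduceRow b a xs rs
  | _, _ => []

/-- The Schur complement of the pivot `b` with first row `r`, rounded to integers, with `K`
subtracted from the diagonal to absorb the rounding. -/
def roundedSchur (b K : ℤ) : List ℤ → List (List ℤ) → List (List ℤ)
  | a :: r, (d :: row) :: C => ((d - a * a / b - K) :: reduceRow b a row r) :: roundedSchur b K r C
  | _, _ => []

/-- Rounded Gaussian elimination on an upper triangular array of size `n`; succeeds if all pivots
are positive. -/
def psdCheck : ℕ → List (List ℤ) → Bool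
  | 0, _ => true
  | n + 1, (b :: r) :: C => decide (0 < b) && psdCheck n (roundedSchur b n r C)
  | _ + 1, _ => false

def listDot : List ℤ → List ℤ → ℤ
  | x :: xs, v :: vs => x * v + listDot xs vs
  | _, _ => 0

/-- The quadratic form of a symmetric matrix given by its upper triangular part. -/
def triForm : List (List ℤ) → List ℤ → ℤ
  | (b :: r) :: C, v :: vs => b * v ^ 2 + 2 * v * listDot r vs + triForm C vs
  | _, _ => 0

/-- An upper triangular array of size `n`. -/
def IsTriangular : ℕ → List (List ℤ) → Prop
  | 0, C => C = []
  | n + 1, r :: C => r.length = n + 1 ∧ IsTriangular n C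
  | _ + 1, [] => False

theorem length_reduceRow (b a : ℤ) (n : ℕ) : ∀ xs rs : List ℤ, xs.length = n → rs.length = n →
    (reduceRow b a xs rs).length = n := by
  induction n with
  | zero =>
    intro xs rs hx hr
    simp_all [reduceRow]
  | succ n ih =>
    intro xs rs hx hr
    obtain _ | ⟨x, xs⟩ := xs
    · simp at hx
    obtain _ | ⟨r, rs⟩ := rs
    · simp at hr
    simp only [List.length_cons, Nat.add_right_cancel_iff] at hx hr
    simp [reduceRow, ih xs rs hx hr]

theorem IsTriangular.roundedSchur {b K : ℤ} (n : ℕ) : ∀ (r : List ℤ) (C : List (List ℤ)),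
    r.length = n → IsTriangular n C → IsTriangular n (roundedSchur b K r C) := by
  induction n with
  | zero =>
    intro r C hr hC
    simp_all [_root_.roundedSchur, IsTriangular]
  | succ n ih =>
    intro r C hr hC
    obtain _ | ⟨a, r⟩ := r
    · simp at hr
    obtain _ | ⟨row, C⟩ := C
    · exact hC.elim
    obtain ⟨h1, h2⟩ := hC
    obtain _ | ⟨d, row⟩ := row
    · simp at h1
    simp only [List.length_cons, Nat.add_right_cancel_iff] at hr h1
    exact ⟨by simp [length_reduceRow b a n row r h1 hr], ih r C hr h2⟩

/-- The rounding error in one row is controlled by the squares of the entries. -/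
theorem two_mul_listDot_reduceRow_le {b : ℤ} (hb : 0 < b) (a x : ℤ) (n : ℕ) :
    ∀ xs rs v : List ℤ, xs.length = n → rs.length = n → v.length = n →
    b * (2 * x * listDot (reduceRow b a xs rs) v) ≤
      b * (2 * x * listDot xs v) - 2 * (a * x) * listDot rs v
        + b * (n * x ^ 2 + listDot v v) := by
  induction n with
  | zero =>
    intro xs rs v hx hr hv
    simp_all [reduceRow, listDot]
  | succ n ih =>
    intro xs rs v hx hr hv
    obtain _ | ⟨y, xs⟩ := xs
    · simp at hx
    obtain _ | ⟨r, rs⟩ := rs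
    · simp at hr
    obtain _ | ⟨w, v⟩ := v
    · simp at hv
    simp only [List.length_cons, Nat.add_right_cancel_iff] at hx hr hv
    have h := ih xs rs v hx hr hv
    have h0 := Int.emod_nonneg (a * r) hb.ne'
    have h1 := Int.emod_lt_of_pos (a * r) hb
    have h2 := Int.mul_ediv_add_emod (a * r) b
    simp only [reduceRow, listDot]
    set e := a * r % b
    set q := a * r / b
    have key : 2 * x * w * e ≤ b * (x ^ 2 + w ^ 2) := by
      nlinarith [mul_nonneg h0 (sq_nonneg (x - w)),
        mul_nonneg (sub_nonneg.2 h1.le) (add_nonneg (sq_nonneg x) (sq_nonneg w))]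
    push_cast
    have : b * (2 * x * (q * w)) = 2 * x * w * (a * r) - 2 * x * w * e := by
      rw [← h2]; ring
    nlinarith [this, key, h]

/-- Taking floors raises each entry of the true Schur complement by an amount in `[0, 1)`, which
adds at most `n * |v|²` to the form. `K` is kept apart from `n` because it stays fixed while the
induction shrinks the matrix. -/
theorem triForm_roundedSchur_le {b : ℤ} (hb : 0 < b) (K : ℤ) (n : ℕ) :
    ∀ (r : List ℤ) (C : List (List ℤ)) (v : List ℤ),
    r.length = n → IsTriangular n C → v.length = n →
    b * triForm (roundedSchur b K r C) v + b * (K - n) * listDot v v ≤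
      b * triForm C v - listDot r v ^ 2 := by
  induction n with
  | zero =>
    intro r C v hr hC hv
    simp_all [roundedSchur, listDot, triForm, IsTriangular]
  | succ n ih =>
    intro r C v hr hC hv
    obtain _ | ⟨a, r⟩ := r
    · simp at hr
    obtain _ | ⟨row, C⟩ := C
    · exact hC.elim
    obtain ⟨h1, h2⟩ := hC
    obtain _ | ⟨d, row⟩ := row
    · simp at h1
    obtain _ | ⟨x, v⟩ := v
    · simp at hv
    simp only [List.length_cons, Nat.add_right_cancel_iff] at hr h1 hv
    have h := ih r C v hr h2 hv
    have hrow := two_mul_listDot_reduceRow_le hb a x n row r v h1 hr hv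
    have e0 := Int.emod_nonneg (a * a) hb.ne'
    have e1 := Int.emod_lt_of_pos (a * a) hb
    have e2 := Int.mul_ediv_add_emod (a * a) b
    simp only [roundedSchur, triForm, listDot]
    set e := a * a % b
    set q := a * a / b
    have hq : b * (q * x ^ 2) = (a * x) ^ 2 - e * x ^ 2 := by
      rw [mul_pow, sq a, ← e2]; ring
    have he : e * x ^ 2 ≤ b * x ^ 2 := mul_le_mul_of_nonneg_right e1.le (sq_nonneg x)
    push_cast
    nlinarith [h, hrow, hq, he]

theorem triForm_nonneg_of_psdCheck (n : ℕ) : ∀ (C : List (List ℤ)) (v : List ℤ),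
    IsTriangular n C → v.length = n → psdCheck n C = true → 0 ≤ triForm C v := by
  induction n with
  | zero =>
    intro C v hC hv h
    simp_all [triForm, IsTriangular]
  | succ n ih =>
    intro C v hC hv h
    obtain _ | ⟨row, C⟩ := C
    · exact hC.elim
    obtain ⟨h1, h2⟩ := hC
    obtain _ | ⟨b, r⟩ := row
    · simp at h1
    obtain _ | ⟨x, v⟩ := v
    · simp at hv
    simp only [List.length_cons, Nat.add_right_cancel_iff] at h1 hv
    simp only [psdCheck, Bool.and_eq_true, decide_eq_true_eq] at h
    obtain ⟨hb, h⟩ := h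
    have h3 := ih _ v (IsTriangular.roundedSchur n r C h1 h2) hv h
    have h4 := triForm_roundedSchur_le hb n n r C v h1 h2 hv
    simp only [triForm]
    have h5 := mul_nonneg hb.le h3
    refine nonneg_of_mul_nonneg_right (a := b) ?_ hb
    -- Completing the square: `b` times the form is `(b x + r·v)²` plus `b` times the form of the
    -- true Schur complement.
    nlinarith [sq_nonneg (b * x + listDot r v)]

/-- The upper triangular part of the matrix `B` with rows and columns `i, …, i + k - 1`. -/
def triRows (B : ℕ → ℕ → ℤ) : ℕ → ℕ → List (List ℤ)
  | _, 0 => []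
  | i, k + 1 => (List.range' i (k + 1)).map (B i) :: triRows B (i + 1) k

theorem isTriangular_triRows (B : ℕ → ℕ → ℤ) (k : ℕ) : ∀ i, IsTriangular k (triRows B i k) := by
  induction k with
  | zero => intro i; rfl
  | succ k ih => intro i; exact ⟨by simp, ih (i + 1)⟩

theorem listDot_map_range' (g v : ℕ → ℤ) (k : ℕ) : ∀ i,
    listDot ((List.range' i k).map g) ((List.range' i k).map v) =
      ∑ a ∈ Finset.range k, g (i + a) * v (i + a) := by
  induction k with
  | zero => intro i; rfl
  | succ k ih =>
    intro i
    rw [Finset.sum_range_succ', List.range'_succ, List.map_cons, List.map_cons, listDot, ih]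
    simp only [add_zero, add_assoc, add_comm 1]
    ring

theorem triForm_triRows {B : ℕ → ℕ → ℤ} (hB : ∀ i j, B i j = B j i) (v : ℕ → ℤ) (k : ℕ) : ∀ i,
    triForm (triRows B i k) ((List.range' i k).map v) =
      ∑ a ∈ Finset.range k, ∑ c ∈ Finset.range k, B (i + a) (i + c) * v (i + a) * v (i + c) := by
  induction k with
  | zero => intro i; rfl
  | succ k ih =>
    intro i
    have h1 : ∑ c ∈ Finset.range k, B (i + (c + 1)) i * v (i + (c + 1)) * v i =
        v i * ∑ c ∈ Finset.range k, B i (i + (c + 1)) * v (i + (c + 1)) := by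
      rw [Finset.mul_sum]
      exact Finset.sum_congr rfl fun c _ => by rw [hB _ i]; ring
    have h2 : ∑ c ∈ Finset.range k, B i (i + (c + 1)) * v i * v (i + (c + 1)) =
        v i * ∑ c ∈ Finset.range k, B i (i + (c + 1)) * v (i + (c + 1)) := by
      rw [Finset.mul_sum]
      exact Finset.sum_congr rfl fun c _ => by ring
    rw [triRows, List.range'_succ, List.map_cons, List.map_cons, triForm, ih, listDot_map_range',
      Finset.sum_range_succ']
    simp only [Finset.sum_range_succ' _ k, Finset.sum_add_distrib, add_zero, add_assoc,
      add_comm 1, h1, h2]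
    ring

theorem sum_nonneg_of_psdCheck {B : ℕ → ℕ → ℤ} (hB : ∀ i j, B i j = B j i) {n : ℕ}
    (h : psdCheck n (triRows B 0 n) = true) (v : ℕ → ℤ) :
    0 ≤ ∑ i ∈ Finset.range n, ∑ j ∈ Finset.range n, B i j * v i * v j := by
  have := triForm_nonneg_of_psdCheck n _ ((List.range' 0 n).map v) (isTriangular_triRows B n 0)
    (by simp) h
  rw [triForm_triRows hB] at this
  simpa using this

/-! ### Monochromatic solutions as a quadratic form

Positions are counted from `0`, so that a solution of `x + y = 3 z` becomes `i + j = 3 k + 1`, and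
colours are signs. -/

/-- The number of monochromatic solutions `i + j = 3 k + 1` with `i, j < n`. -/
def monoPairs (F : ℕ → ℤ) (n : ℕ) : ℕ :=
  ((Finset.range n ×ˢ Finset.range n).filter fun p : ℕ × ℕ =>
    (p.1 + p.2) % 3 = 1 ∧ F p.1 = F p.2 ∧ F p.2 = F ((p.1 + p.2) / 3)).card

theorem monoPairs_mono (F : ℕ → ℤ) {m n : ℕ} (h : m ≤ n) : monoPairs F m ≤ monoPairs F n := by
  unfold monoPairs
  gcongr

theorem sum_range_mul_add {M : Type*} [AddCommMonoid M] (g : ℕ → M) (p q : ℕ) :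
    ∑ i ∈ Finset.range (p * q), g i = ∑ k ∈ Finset.range q, ∑ r ∈ Finset.range p, g (p * k + r) := by
  induction q with
  | zero => simp
  | succ q ih => rw [Nat.mul_succ, Finset.sum_range_add, ih, Finset.sum_range_succ]

theorem sum_range_three_mul {M : Type*} [AddCommMonoid M] (g : ℕ → M) (q : ℕ) :
    ∑ i ∈ Finset.range (3 * q), g i =
      ∑ k ∈ Finset.range q, (g (3 * k) + g (3 * k + 1) + g (3 * k + 2)) := by
  simp [sum_range_mul_add, Finset.sum_range_succ]

theorem sum_pairs_eq_sum_window {n i : ℕ} (hi : i < n) (g : ℕ → ℤ) :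
    ∑ j ∈ Finset.range n, (if (i + j) % 3 = 1 then g ((i + j) / 3) else 0) =
      ∑ k ∈ Finset.range n, if i ≤ 3 * k + 1 ∧ 3 * k + 1 < n + i then g k else 0 := by
  rw [← Finset.sum_filter, ← Finset.sum_filter]
  refine Finset.sum_bij' (fun j _ => (i + j) / 3) (fun k _ => 3 * k + 1 - i) ?_ ?_ ?_ ?_ ?_ <;>
    simp only [Finset.mem_filter, Finset.mem_range, implies_true] <;> intros <;> omega

/-- The residues mod 3 of `i` and `j` can only be `(0, 1)`, `(1, 0)` or `(2, 2)`, so the sum factors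
over residue classes. -/
theorem sum_pairs_mul (g : ℕ → ℤ) (q : ℕ) :
    ∑ i ∈ Finset.range (3 * q), ∑ j ∈ Finset.range (3 * q),
        (if (i + j) % 3 = 1 then g i * g j else 0) =
      2 * (∑ k ∈ Finset.range q, g (3 * k)) * (∑ k ∈ Finset.range q, g (3 * k + 1)) +
        (∑ k ∈ Finset.range q, g (3 * k + 2)) ^ 2 := by
  have h : ∀ k l : ℕ,
      (if (3 * k + (3 * l)) % 3 = 1 then g (3 * k) * g (3 * l) else 0) = 0 ∧
      (if (3 * k + (3 * l + 1)) % 3 = 1 then g (3 * k) * g (3 * l + 1) else 0) =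
        g (3 * k) * g (3 * l + 1) ∧
      (if (3 * k + (3 * l + 2)) % 3 = 1 then g (3 * k) * g (3 * l + 2) else 0) = 0 ∧
      (if (3 * k + 1 + (3 * l)) % 3 = 1 then g (3 * k + 1) * g (3 * l) else 0) =
        g (3 * k + 1) * g (3 * l) ∧
      (if (3 * k + 1 + (3 * l + 1)) % 3 = 1 then g (3 * k + 1) * g (3 * l + 1) else 0) = 0 ∧
      (if (3 * k + 1 + (3 * l + 2)) % 3 = 1 then g (3 * k + 1) * g (3 * l + 2) else 0) = 0 ∧
      (if (3 * k + 2 + (3 * l)) % 3 = 1 then g (3 * k + 2) * g (3 * l) else 0) = 0 ∧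
      (if (3 * k + 2 + (3 * l + 1)) % 3 = 1 then g (3 * k + 2) * g (3 * l + 1) else 0) = 0 ∧
      (if (3 * k + 2 + (3 * l + 2)) % 3 = 1 then g (3 * k + 2) * g (3 * l + 2) else 0) =
        g (3 * k + 2) * g (3 * l + 2) := by
    intro k l
    refine ⟨if_neg (by omega), if_pos (by omega), if_neg (by omega), if_pos (by omega),
      if_neg (by omega), if_neg (by omega), if_neg (by omega), if_neg (by omega),
      if_pos (by omega)⟩
  simp only [sum_range_three_mul]
  simp only [h, add_zero, zero_add]
  simp only [Finset.sum_add_distrib, ← Finset.mul_sum, ← Finset.sum_mul]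
  ring

/-- For signs, `1 + ab + ac + bc` is 4 if `a = b = c` and 0 otherwise. -/
theorem four_mul_monoPairs {F : ℕ → ℤ} (hF : ∀ i, F i = 1 ∨ F i = -1) (n : ℕ) :
    4 * (monoPairs F n : ℤ) = ∑ i ∈ Finset.range n, ∑ j ∈ Finset.range n,
      if (i + j) % 3 = 1 then 1 + F i * F j + F i * F ((i + j) / 3) + F j * F ((i + j) / 3)
      else 0 := by
  rw [monoPairs, Finset.card_filter, Finset.sum_product, Nat.cast_sum, Finset.mul_sum]
  refine Finset.sum_congr rfl fun i _ => ?_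
  rw [Nat.cast_sum, Finset.mul_sum]
  refine Finset.sum_congr rfl fun j _ => ?_
  by_cases h : (i + j) % 3 = 1
  · rcases hF i with h1 | h1 <;> rcases hF j with h2 | h2 <;>
      rcases hF ((i + j) / 3) with h3 | h3 <;> simp [h, h1, h2, h3]
  · simp [h]

/-- The sum of `F` over the `i < n` that occur in a solution with third entry `k`. -/
def windowSum (F : ℕ → ℤ) (n k : ℕ) : ℤ :=
  ∑ i ∈ Finset.range n, if i ≤ 3 * k + 1 ∧ 3 * k + 1 < n + i then F i else 0

theorem four_mul_monoPairs_eq {F : ℕ → ℤ} (hF : ∀ i, F i = 1 ∨ F i = -1) (q : ℕ) :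
    4 * (monoPairs F (3 * q) : ℤ) = 3 * (q : ℤ) ^ 2 +
      ∑ i ∈ Finset.range (3 * q), ∑ j ∈ Finset.range (3 * q),
        (if (i + j) % 3 = 1 then F i * F j else 0) +
      2 * ∑ k ∈ Finset.range (3 * q), F k * windowSum F (3 * q) k := by
  set n := 3 * q with hn
  have h1 : ∑ i ∈ Finset.range n, ∑ j ∈ Finset.range n,
      (if (i + j) % 3 = 1 then (1 : ℤ) else 0) = 3 * (q : ℤ) ^ 2 := by
    have := sum_pairs_mul (fun _ => 1) q
    simp only [mul_one, Finset.sum_const, Finset.card_range, nsmul_eq_mul] at this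
    rw [hn, this]
    ring
  have h2 : ∑ i ∈ Finset.range n, ∑ j ∈ Finset.range n,
      (if (i + j) % 3 = 1 then F i * F ((i + j) / 3) else 0) =
        ∑ k ∈ Finset.range n, F k * windowSum F n k := by
    have : ∀ i ∈ Finset.range n, ∑ j ∈ Finset.range n,
        (if (i + j) % 3 = 1 then F i * F ((i + j) / 3) else 0) = ∑ k ∈ Finset.range n,
          F k * (if i ≤ 3 * k + 1 ∧ 3 * k + 1 < n + i then F i else 0) := by
      intro i hi
      rw [sum_pairs_eq_sum_window (Finset.mem_range.1 hi) fun k => F i * F k]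
      refine Finset.sum_congr rfl fun k _ => ?_
      split_ifs <;> ring
    rw [Finset.sum_congr rfl this, Finset.sum_comm]
    simp only [windowSum, Finset.mul_sum]
  have h3 : ∑ i ∈ Finset.range n, ∑ j ∈ Finset.range n,
      (if (i + j) % 3 = 1 then F j * F ((i + j) / 3) else 0) =
        ∑ k ∈ Finset.range n, F k * windowSum F n k := by
    rw [← h2, Finset.sum_comm]
    simp only [add_comm]
  rw [four_mul_monoPairs hF, two_mul, ← h1]
  nth_rw 1 [← h2]
  rw [← h3]
  simp only [← Finset.sum_add_distrib]
  refine Finset.sum_congr rfl fun i _ => Finset.sum_congr rfl fun j _ => ?_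
  split_ifs <;> ring

/-! ### Small cases: a diagonal shift by residue classes -/

/-- The coefficient of `F i * F j` in four times the number of monochromatic solutions. -/
def solutionWeight (n i j : ℕ) : ℤ :=
  (if (i + j) % 3 = 1 then 1 else 0) + 2 * (if i ≤ 3 * j + 1 ∧ 3 * j + 1 < n + i then 1 else 0)

/-- Symmetrised `solutionWeight`, with a diagonal term depending on the residue class. -/
def shiftedSolutionMatrix (n : ℕ) (al be : ℤ) (i j : ℕ) : ℤ :=
  1000 * (1000 * (solutionWeight n i j + solutionWeight n j i)
    + if i = j then 2 * (if i % 3 = 2 then be else al) else 0)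

theorem sum_symm_add_diag (w : ℕ → ℕ → ℤ) (d v : ℕ → ℤ) (c : ℤ) (n : ℕ) :
    ∑ i ∈ Finset.range n, ∑ j ∈ Finset.range n,
        (c * (w i j + w j i) + if i = j then d i else 0) * v i * v j =
      2 * c * (∑ i ∈ Finset.range n, ∑ j ∈ Finset.range n, w i j * v i * v j) +
        ∑ i ∈ Finset.range n, d i * v i ^ 2 := by
  have h : ∑ i ∈ Finset.range n, ∑ j ∈ Finset.range n, w j i * v i * v j =
      ∑ i ∈ Finset.range n, ∑ j ∈ Finset.range n, w i j * v i * v j := by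
    rw [Finset.sum_comm]
    exact Finset.sum_congr rfl fun i _ => Finset.sum_congr rfl fun j _ => by ring
  have h' : ∀ i ∈ Finset.range n, ∑ j ∈ Finset.range n, (if i = j then d i * v i * v j else 0) =
      d i * v i ^ 2 := by
    intro i hi
    rw [Finset.sum_ite_eq, if_pos hi]
    ring
  rw [← Finset.sum_congr rfl h', mul_assoc, two_mul]
  nth_rw 2 [← h]
  simp only [Finset.mul_sum, ← Finset.sum_add_distrib]
  refine Finset.sum_congr rfl fun i _ => Finset.sum_congr rfl fun j _ => ?_
  split_ifs <;> ring

/-- Since `F i ^ 2 = 1`, the diagonal shift costs exactly `q * (2 * al + be)`, where `al` and `be`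
are in thousandths. The outer factor 1000 of the matrix only leaves room for the rounding in
`psdCheck`. -/
theorem le_monoPairs_of_psdCheck {q : ℕ} {al be : ℤ}
    (h : psdCheck (3 * q) (triRows (shiftedSolutionMatrix (3 * q) al be) 0 (3 * q)) = true)
    {F : ℕ → ℤ} (hF : ∀ i, F i = 1 ∨ F i = -1) :
    3000 * (q : ℤ) ^ 2 - q * (2 * al + be) ≤ 4000 * (monoPairs F (3 * q) : ℤ) := by
  have hsym : ∀ i j, shiftedSolutionMatrix (3 * q) al be i j =
      shiftedSolutionMatrix (3 * q) al be j i := by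
    intro i j
    rcases eq_or_ne i j with rfl | hij
    · rfl
    · simp only [shiftedSolutionMatrix, if_neg hij, if_neg hij.symm]
      ring
  have h0 := sum_nonneg_of_psdCheck hsym h F
  simp only [shiftedSolutionMatrix, mul_assoc (1000 : ℤ), ← Finset.mul_sum] at h0
  replace h0 := nonneg_of_mul_nonneg_right h0 (by norm_num)
  rw [sum_symm_add_diag (solutionWeight (3 * q)) (fun i => 2 * if i % 3 = 2 then be else al)] at h0
  have hsq : ∀ i, F i ^ 2 = 1 := fun i => by rcases hF i with h | h <;> simp [h]
  have hd : ∑ i ∈ Finset.range (3 * q), (2 * if i % 3 = 2 then be else al) * F i ^ 2 =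
      2 * (q * (2 * al + be)) := by
    rw [sum_range_three_mul]
    simp only [hsq, Nat.mul_mod_right, Nat.mul_add_mod]
    simp
    ring
  have hw : ∑ i ∈ Finset.range (3 * q), ∑ j ∈ Finset.range (3 * q),
      solutionWeight (3 * q) i j * F i * F j = 4 * (monoPairs F (3 * q) : ℤ) - 3 * (q : ℤ) ^ 2 := by
    rw [four_mul_monoPairs_eq hF, add_assoc, add_sub_cancel_left]
    simp only [windowSum, Finset.mul_sum]
    rw [Finset.sum_comm (f := fun k i =>
      2 * (F k * if i ≤ 3 * k + 1 ∧ 3 * k + 1 < 3 * q + i then F i else 0)),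
      ← Finset.sum_add_distrib]
    refine Finset.sum_congr rfl fun i _ => ?_
    rw [← Finset.sum_add_distrib]
    refine Finset.sum_congr rfl fun j _ => ?_
    unfold solutionWeight
    split_ifs <;> ring
  rw [hd, hw] at h0
  linarith

/-! ### Large cases: averaging over blocks -/

/-- `G` varies by at most one per step. -/
def UnitSteps (G : ℕ → ℤ) : Prop := ∀ x y, x ≤ y → |G y - G x| ≤ (y : ℤ) - x

/-- If the two deviations have opposite signs, their absolute values add to `2 |G i - G j|`,
controlled by `j - i`. If the signs agree, they add to `2 |(G i - G a) - (G b - G j)|`, controlled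
by the two outer gaps. -/
theorem UnitSteps.abs_add_abs_le {G : ℕ → ℤ} (hG : UnitSteps G) {a b i j : ℕ} {M : ℤ}
    (hai : a ≤ i) (hij : i ≤ j) (hjb : j ≤ b) (h1 : (j : ℤ) - i ≤ M)
    (h2 : (i : ℤ) - a + (b - j) ≤ M) :
    |2 * G i - G a - G b| + |2 * G j - G a - G b| ≤ 2 * M := by
  have k1 := abs_le.1 (hG a i hai)
  have k2 := abs_le.1 (hG i j hij)
  have k3 := abs_le.1 (hG j b hjb)
  rcases abs_cases (2 * G i - G a - G b) with h | h <;>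
    rcases abs_cases (2 * G j - G a - G b) with h' | h' <;> linarith

/-- The average deviation of a unit-step function on an interval of length `3 p` from the mean of
its boundary values is at most about a quarter of the length. -/
theorem UnitSteps.sum_abs_le {G : ℕ → ℤ} (hG : UnitSteps G) (a p : ℕ) :
    2 * ∑ r ∈ Finset.range p, |2 * G (a + (3 * r + 2)) - G a - G (a + 3 * p)| ≤
      3 * p * (p + 1) := by
  set d : ℕ → ℤ := fun r => |2 * G (a + (3 * r + 2)) - G a - G (a + 3 * p)| with hd
  obtain ⟨k, l, hp, hkl, hlk⟩ : ∃ k l, p = k + l ∧ k ≤ l ∧ l ≤ k + 1 :=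
    ⟨p / 2, p - p / 2, by omega, by omega, by omega⟩
  -- The sum is taken twice and regrouped into pairs at distance `3 l` or `3 k`, which treats odd
  -- and even `p` alike.
  have e1 : ∑ r ∈ Finset.range p, d r =
      ∑ r ∈ Finset.range k, d r + ∑ r ∈ Finset.range l, d (k + r) := by
    rw [hp, Finset.sum_range_add]
  have e2 : ∑ r ∈ Finset.range p, d r =
      ∑ r ∈ Finset.range l, d r + ∑ r ∈ Finset.range k, d (l + r) := by
    rw [hp, add_comm k l, Finset.sum_range_add]
  have b1 : ∑ r ∈ Finset.range k, (d r + d (l + r)) ≤ ∑ r ∈ Finset.range k, 2 * (3 * (l : ℤ)) := by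
    refine Finset.sum_le_sum fun r hr => ?_
    have := Finset.mem_range.1 hr
    refine hG.abs_add_abs_le (by omega) (by omega) (by omega) ?_ ?_ <;> push_cast [hp] <;> linarith
  have b2 : ∑ r ∈ Finset.range l, (d r + d (k + r)) ≤ ∑ r ∈ Finset.range l, 2 * (3 * (l : ℤ)) := by
    refine Finset.sum_le_sum fun r hr => ?_
    have := Finset.mem_range.1 hr
    refine hG.abs_add_abs_le (by omega) (by omega) (by omega) ?_ ?_ <;> push_cast [hp] <;> linarith
  simp only [Finset.sum_add_distrib, Finset.sum_const, Finset.card_range, nsmul_eq_mul] at b1 b2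
  have hl : 2 * (l : ℤ) ≤ p + 1 := by omega
  have hp' : (p : ℤ) = k + l := by omega
  have hp0 : (0 : ℤ) ≤ p := by omega
  have : 2 * ∑ r ∈ Finset.range p, d r ≤ p * (6 * l) := by
    rw [hp'] ; linarith
  nlinarith

theorem unitSteps_sum_range {F : ℕ → ℤ} (hF : ∀ i, |F i| ≤ 1) :
    UnitSteps fun x => ∑ i ∈ Finset.range x, F i := by
  intro x y hxy
  obtain ⟨k, rfl⟩ := Nat.exists_eq_add_of_le hxy
  simp only [Finset.sum_range_add, add_sub_cancel_left]
  refine (Finset.abs_sum_le_sum_abs _ _).trans ?_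
  refine (Finset.sum_le_sum fun i _ => hF (x + i)).trans ?_
  simp

/-- Twice the weight of the block `K` in the average of the windows of the block `J`, when
`[0, n)` is divided into `3 m` blocks of equal length. -/
def windowWeight (m J K : ℕ) : ℤ :=
  if J < m then (if K / 3 < J then 2 else if K / 3 = J then 1 else 0)
  else if J < 2 * m then (if J < m + K / 3 then 2 else if J = m + K / 3 then 1 else 0)
  else 0

/-- The matrix of the block form with a diagonal shift, scaled. -/
def blockMatrix (m J K : ℕ) : ℤ :=
  1000000 * (3 * (windowWeight m J K + windowWeight m K J) + if J = K then 4 * (m : ℤ) else 0)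

theorem sum_ite_lt_of_le (D : ℕ → ℤ) {J m : ℕ} (h : J ≤ m) :
    ∑ j ∈ Finset.range m, (if j < J then D j else 0) = ∑ j ∈ Finset.range J, D j := by
  rw [← Finset.sum_filter]
  congr 1
  ext j
  simp only [Finset.mem_filter, Finset.mem_range]
  omega

/-- The weights 2, 1, 0 are the sum of the indicators of `j < J` and `j < J + 1`, and each of these
telescopes. -/
theorem sum_step_weight {G : ℕ → ℤ} (hG : G 0 = 0) {s J m : ℕ} (h : J < m) :
    ∑ j ∈ Finset.range m, (if j < J then 2 else if j = J then 1 else 0) *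
        (G (s * (j + 1)) - G (s * j)) = G (s * J) + G (s * (J + 1)) := by
  have key : ∀ L ≤ m, ∑ j ∈ Finset.range m,
      (if j < L then G (s * (j + 1)) - G (s * j) else 0) = G (s * L) := by
    intro L hL
    rw [sum_ite_lt_of_le _ hL, Finset.sum_range_sub fun j => G (s * j)]
    simp [hG]
  rw [← key J h.le, ← key (J + 1) h, ← Finset.sum_add_distrib]
  refine Finset.sum_congr rfl fun j _ => ?_
  rcases lt_trichotomy j J with hj | rfl | hj
  · simp [hj, Nat.lt_succ_of_lt hj]; ring
  · simp
  · simp [hj.not_gt, hj.ne', not_lt.2 (Nat.succ_le_of_lt hj)]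

theorem sum_windowWeight (m J : ℕ) (v : ℕ → ℤ) :
    ∑ K ∈ Finset.range (3 * m), windowWeight m J K * v K = ∑ j ∈ Finset.range m,
      windowWeight m J (3 * j) * (v (3 * j) + v (3 * j + 1) + v (3 * j + 2)) := by
  rw [sum_range_three_mul]
  refine Finset.sum_congr rfl fun j _ => ?_
  have h1 : (3 * j + 1) / 3 = 3 * j / 3 := by omega
  have h2 : (3 * j + 2) / 3 = 3 * j / 3 := by omega
  simp only [windowWeight, h1, h2]
  ring

section

variable {F : ℕ → ℤ} {m p : ℕ}

/-- The sum of `F` over the block `J` of length `p`. -/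
def blockSum (F : ℕ → ℤ) (p J : ℕ) : ℤ := ∑ r ∈ Finset.range p, F (p * J + r)

theorem blockSum_three (F : ℕ → ℤ) (p j : ℕ) :
    blockSum F p (3 * j) + blockSum F p (3 * j + 1) + blockSum F p (3 * j + 2) =
      ∑ i ∈ Finset.range (3 * p * (j + 1)), F i - ∑ i ∈ Finset.range (3 * p * j), F i := by
  rw [show 3 * p * (j + 1) = p * (3 * j + 1 + 1 + 1) by ring, show 3 * p * j = p * (3 * j) by ring]
  simp only [sum_range_mul_add, Finset.sum_range_succ _ (3 * j), Finset.sum_range_succ _ (3 * j + 1),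
    Finset.sum_range_succ _ (3 * j + 1 + 1), blockSum]
  ring

/-- In the first third of the positions only the upper end of the window binds, so it is a prefix.
In the second third only the lower end binds, so it is the complement of a prefix. In the last third
it is empty. -/
theorem windowSum_of_lt {J r : ℕ} (hJ : J < m) (hr : r < p) :
    windowSum F (3 * p * m) (p * J + r) = ∑ i ∈ Finset.range (3 * p * J + (3 * r + 2)), F i := by
  have h : p * (J + 1) ≤ p * m := Nat.mul_le_mul_left p hJ
  rw [mul_add, mul_one] at h
  rw [← sum_ite_lt_of_le F (J := 3 * p * J + (3 * r + 2)) (m := 3 * p * m) (by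
    simp only [mul_assoc]; omega), windowSum]
  refine Finset.sum_congr rfl fun i hi => ?_
  congr 1
  simp only [mul_assoc, eq_iff_iff]
  omega

theorem windowSum_of_ge {J r : ℕ} (hJ : J < m) (hr : r < p) :
    windowSum F (3 * p * m) (p * (m + J) + r) = ∑ i ∈ Finset.range (3 * p * m), F i -
      ∑ i ∈ Finset.range (3 * p * J + (3 * r + 2)), F i := by
  have h : p * (J + 1) ≤ p * m := Nat.mul_le_mul_left p hJ
  rw [mul_add, mul_one] at h
  rw [← sum_ite_lt_of_le F (J := 3 * p * J + (3 * r + 2)) (m := 3 * p * m) (by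
    simp only [mul_assoc]; omega), windowSum, ← Finset.sum_sub_distrib]
  refine Finset.sum_congr rfl fun i hi => ?_
  have hi := Finset.mem_range.1 hi
  simp only [mul_assoc, mul_add] at hi ⊢
  split_ifs <;> omega

theorem windowSum_eq_zero {k : ℕ} (hk : 2 * (p * m) ≤ k) :
    windowSum F (3 * p * m) k = 0 := by
  refine Finset.sum_eq_zero fun i hi => if_neg ?_
  have hi := Finset.mem_range.1 hi
  simp only [mul_assoc] at hi ⊢
  omega

theorem sum_windowWeight_of_lt {J : ℕ} (hJ : J < m) :
    ∑ K ∈ Finset.range (3 * m), windowWeight m J K * blockSum F p K =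
      ∑ i ∈ Finset.range (3 * p * J), F i + ∑ i ∈ Finset.range (3 * p * (J + 1)), F i := by
  rw [sum_windowWeight, ← sum_step_weight (G := fun x => ∑ i ∈ Finset.range x, F i) (by simp) hJ]
  refine Finset.sum_congr rfl fun j _ => ?_
  simp [windowWeight, hJ, blockSum_three]

theorem sum_windowWeight_of_ge {J : ℕ} (hJ : J < m) :
    ∑ K ∈ Finset.range (3 * m), windowWeight m (m + J) K * blockSum F p K =
      2 * ∑ i ∈ Finset.range (3 * p * m), F i -
      (∑ i ∈ Finset.range (3 * p * J), F i + ∑ i ∈ Finset.range (3 * p * (J + 1)), F i) := by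
  have h0 : ∑ i ∈ Finset.range (3 * p * m), F i = ∑ j ∈ Finset.range m,
      (∑ i ∈ Finset.range (3 * p * (j + 1)), F i - ∑ i ∈ Finset.range (3 * p * j), F i) := by
    rw [Finset.sum_range_sub fun j => ∑ i ∈ Finset.range (3 * p * j), F i]
    simp
  rw [sum_windowWeight, ← sum_step_weight (G := fun x => ∑ i ∈ Finset.range x, F i) (by simp) hJ,
    h0, Finset.mul_sum, ← Finset.sum_sub_distrib]
  refine Finset.sum_congr rfl fun j _ => ?_
  have h1 : ¬ m + J < m := by omega
  have h2 : m + J < 2 * m := by omega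
  simp only [windowWeight, h1, h2, if_true, if_false, blockSum_three, ← sub_mul]
  congr 1
  simp only [Nat.mul_div_cancel_left j (by norm_num : 0 < 3)]
  split_ifs <;> omega

theorem sum_windowWeight_eq_zero {J : ℕ} (hJ : 2 * m ≤ J) :
    ∑ K ∈ Finset.range (3 * m), windowWeight m J K * blockSum F p K = 0 := by
  refine Finset.sum_eq_zero fun K _ => ?_
  rw [windowWeight, if_neg (by omega), if_neg (by omega), zero_mul]

/-- Replacing the windows of a block by their average changes little. -/
theorem blockSum_mul_le (hF : ∀ i, |F i| ≤ 1) {J : ℕ} (hJ : J < 3 * m) :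
    2 * (blockSum F p J * ∑ K ∈ Finset.range (3 * m), windowWeight m J K * blockSum F p K) ≤
      4 * ∑ r ∈ Finset.range p, F (p * J + r) * windowSum F (3 * p * m) (p * J + r) +
        if J < 2 * m then 3 * (p : ℤ) * (p + 1) else 0 := by
  set c := ∑ K ∈ Finset.range (3 * m), windowWeight m J K * blockSum F p K with hc
  have hdev : blockSum F p J * c -
      2 * ∑ r ∈ Finset.range p, F (p * J + r) * windowSum F (3 * p * m) (p * J + r) ≤
      ∑ r ∈ Finset.range p, |2 * windowSum F (3 * p * m) (p * J + r) - c| := by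
    rw [blockSum, Finset.sum_mul, Finset.mul_sum, ← Finset.sum_sub_distrib]
    refine Finset.sum_le_sum fun r _ => ?_
    have h1 := hF (p * J + r)
    calc F (p * J + r) * c - 2 * (F (p * J + r) * windowSum F (3 * p * m) (p * J + r))
        ≤ |F (p * J + r) * (c - 2 * windowSum F (3 * p * m) (p * J + r))| := by
          refine le_trans (le_of_eq ?_) (le_abs_self _); ring
      _ ≤ 1 * |c - 2 * windowSum F (3 * p * m) (p * J + r)| := by
          rw [abs_mul]; exact mul_le_mul_of_nonneg_right h1 (abs_nonneg _)
      _ = _ := by rw [one_mul, abs_sub_comm]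
  suffices 2 * ∑ r ∈ Finset.range p, |2 * windowSum F (3 * p * m) (p * J + r) - c| ≤
      if J < 2 * m then 3 * (p : ℤ) * (p + 1) else 0 by linarith
  have hG := (unitSteps_sum_range hF).sum_abs_le
  rcases lt_or_ge J m with h | h
  · rw [if_pos (by omega)]
    refine le_trans (le_of_eq ?_) (hG (3 * p * J) p)
    congr 1
    refine Finset.sum_congr rfl fun r hr => ?_
    rw [windowSum_of_lt h (Finset.mem_range.1 hr), hc, sum_windowWeight_of_lt h, mul_add_one,
      sub_add_eq_sub_sub]
  rcases lt_or_ge J (2 * m) with h' | h'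
  · rw [if_pos h']
    obtain ⟨L, rfl⟩ := Nat.exists_eq_add_of_le h
    have hL : L < m := by omega
    refine le_trans (le_of_eq ?_) (hG (3 * p * L) p)
    congr 1
    refine Finset.sum_congr rfl fun r hr => ?_
    rw [windowSum_of_ge hL (Finset.mem_range.1 hr), hc, sum_windowWeight_of_ge hL, mul_add_one,
      ← abs_neg]
    congr 1
    ring
  · rw [if_neg (by omega), hc, sum_windowWeight_eq_zero h', Finset.sum_eq_zero, mul_zero]
    intro r _
    rw [windowSum_eq_zero]
    · simp
    · nlinarith

/-- Semidefiniteness bounds the averaged form below by `-(2 m / 3)` times the sum of squared block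
sums. The averaging error arises only in the first `2 m` blocks. -/
theorem sum_mul_windowSum_ge (hF : ∀ i, |F i| ≤ 1)
    (h : psdCheck (3 * m) (triRows (blockMatrix m) 0 (3 * m)) = true) :
    -(2 * (m : ℤ) * ∑ J ∈ Finset.range (3 * m), blockSum F p J ^ 2) - 9 * m * p * (p + 1) ≤
      6 * ∑ k ∈ Finset.range (3 * p * m), F k * windowSum F (3 * p * m) k := by
  have hsym : ∀ i j, blockMatrix m i j = blockMatrix m j i := by
    intro i j
    rcases eq_or_ne i j with rfl | hij
    · rfl
    · simp only [blockMatrix, if_neg hij, if_neg hij.symm]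
      ring
  have h0 := sum_nonneg_of_psdCheck hsym h (blockSum F p)
  simp only [blockMatrix, mul_assoc (1000000 : ℤ), ← Finset.mul_sum] at h0
  replace h0 := nonneg_of_mul_nonneg_right h0 (by norm_num)
  rw [sum_symm_add_diag (windowWeight m) (fun _ => 4 * (m : ℤ)), ← Finset.mul_sum] at h0
  have h1 := Finset.sum_le_sum fun J hJ =>
    blockSum_mul_le (m := m) (p := p) hF (Finset.mem_range.1 hJ)
  rw [← Finset.mul_sum, Finset.sum_add_distrib, ← Finset.mul_sum, ← sum_range_mul_add
    (fun k => F k * windowSum F (3 * p * m) k), sum_ite_lt_of_le _ (by omega), Finset.sum_const,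
    Finset.card_range, nsmul_eq_mul, show p * (3 * m) = 3 * p * m by ring] at h1
  have h2 : ∑ J ∈ Finset.range (3 * m), blockSum F p J *
      ∑ K ∈ Finset.range (3 * m), windowWeight m J K * blockSum F p K =
      ∑ J ∈ Finset.range (3 * m), ∑ K ∈ Finset.range (3 * m),
        windowWeight m J K * blockSum F p J * blockSum F p K := by
    refine Finset.sum_congr rfl fun J _ => ?_
    rw [Finset.mul_sum]
    exact Finset.sum_congr rfl fun K _ => by ring
  rw [h2] at h1
  push_cast at h1
  linarith

end

/-- With `s = |a + b|` the left side is at most `9 (2t - s)² + 4 (s + t)²`. This is convex in `s` on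
`[0, 2t]`, with end values `40 t²` and `36 t²`. -/
theorem nine_mul_sq_add_le {a b c t : ℤ} (ha : |a| ≤ t) (hb : |b| ≤ t) (hc : |c| ≤ t) :
    9 * (a - b) ^ 2 + 4 * (a + b + c) ^ 2 ≤ 40 * t ^ 2 := by
  have ht : 0 ≤ t := (abs_nonneg a).trans ha
  have h1 : |a + b| + |a - b| ≤ 2 * t := by
    rcases abs_cases a with h | h <;> rcases abs_cases b with h' | h' <;>
      rcases abs_cases (a + b) with k | k <;> rcases abs_cases (a - b) with k' | k' <;> linarith
  have h2 : |a + b + c| ≤ |a + b| + t := (abs_add_le _ _).trans (by linarith)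
  have h3 : (a - b) ^ 2 ≤ (2 * t - |a + b|) ^ 2 := by
    rw [← sq_abs (a - b)]
    exact pow_le_pow_left₀ (abs_nonneg _) (by linarith) 2
  have h4 : (a + b + c) ^ 2 ≤ (|a + b| + t) ^ 2 := by
    rw [← sq_abs (a + b + c)]
    exact pow_le_pow_left₀ (abs_nonneg _) h2 2
  have h5 : |a + b| ≤ 2 * t := by linarith [abs_nonneg (a - b)]
  nlinarith [abs_nonneg (a + b), mul_nonneg (abs_nonneg (a + b)) (sub_nonneg.2 h5)]

/-- A quadratic lower bound for the number of monochromatic solutions. -/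
theorem le_monoPairs_of_blockMatrix {m : ℕ}
    (h : psdCheck (3 * m) (triRows (blockMatrix m) 0 (3 * m)) = true) (t : ℕ)
    {F : ℕ → ℤ} (hF : ∀ i, F i = 1 ∨ F i = -1) :
    7 * (m : ℤ) ^ 2 * t ^ 2 - 9 * m * t * (3 * t + 1) ≤ 4 * (monoPairs F (9 * m * t) : ℤ) := by
  have hF' : ∀ i, |F i| ≤ 1 := fun i => by rcases hF i with h | h <;> simp [h]
  have hQ := sum_mul_windowSum_ge (p := 3 * t) hF' h
  have hn : 3 * (3 * t) * m = 3 * (3 * t * m) := by ring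
  rw [hn] at hQ
  have hC := four_mul_monoPairs_eq hF (3 * t * m)
  rw [sum_pairs_mul] at hC
  rw [show 9 * m * t = 3 * (3 * t * m) by ring, hC]
  let a : ℕ → ℕ → ℤ := fun c J => ∑ k ∈ Finset.range t, F (3 * (t * J + k) + c)
  have hres : ∀ c, ∑ k ∈ Finset.range (3 * t * m), F (3 * k + c) =
      ∑ J ∈ Finset.range (3 * m), a c J := by
    intro c
    rw [show 3 * t * m = t * (3 * m) by ring, sum_range_mul_add]
  have hblock : ∀ J, blockSum F (3 * t) J = a 0 J + a 1 J + a 2 J := by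
    intro J
    rw [blockSum, sum_range_three_mul, Finset.sum_add_distrib, Finset.sum_add_distrib]
    simp only [a, mul_add, mul_assoc, add_assoc, add_zero]
  have ha : ∀ c J, |a c J| ≤ t := by
    intro c J
    refine (Finset.abs_sum_le_sum_abs _ _).trans ?_
    refine (Finset.sum_le_sum fun k _ => hF' _).trans ?_
    simp
  have h0 := hres 0
  simp only [add_zero] at h0
  rw [h0, hres 1, hres 2]
  -- With `S c` the sum over residue class `c`, the only possibly negative residue term satisfies `4
  -- S₀ S₁ ≥ -(S₀ - S₁)²`. Cauchy–Schwarz makes it a sum over blocks, to be bounded block by block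
  -- together with the squared block sums.
  have hCS : (∑ J ∈ Finset.range (3 * m), (a 0 J - a 1 J)) ^ 2 ≤
      (3 * m) * ∑ J ∈ Finset.range (3 * m), (a 0 J - a 1 J) ^ 2 := by
    have := sq_sum_le_card_mul_sum_sq (s := Finset.range (3 * m)) (f := fun J => a 0 J - a 1 J)
    simpa using this
  rw [Finset.sum_sub_distrib] at hCS
  have hsum : 9 * ∑ J ∈ Finset.range (3 * m), (a 0 J - a 1 J) ^ 2 +
      4 * ∑ J ∈ Finset.range (3 * m), blockSum F (3 * t) J ^ 2 ≤ 3 * m * (40 * t ^ 2) := by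
    rw [Finset.mul_sum, Finset.mul_sum, ← Finset.sum_add_distrib]
    refine (Finset.sum_le_sum fun J _ => ?_).trans
      (le_of_eq (b := 3 * (m : ℤ) * (40 * t ^ 2)) (a := ∑ J ∈ Finset.range (3 * m), 40 * (t : ℤ) ^ 2)
        (by simp))
    rw [hblock]
    exact nine_mul_sq_add_le (ha 0 J) (ha 1 J) (ha 2 J)
  have hsum' := mul_le_mul_of_nonneg_left hsum (Int.natCast_nonneg m)
  push_cast at hQ ⊢
  -- After multiplication by 3, the main term `81 m² t²` loses at most `60 m² t²`, and `21 / 3 = 7`.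
  nlinarith [sq_nonneg (∑ J ∈ Finset.range (3 * m), a 0 J + ∑ J ∈ Finset.range (3 * m), a 1 J),
    sq_nonneg (∑ J ∈ Finset.range (3 * m), a 2 J)]

/-! ### The lower bound for all `n` -/

theorem two_le_monoPairs {F : ℕ → ℤ} (hF : ∀ i, F i = 1 ∨ F i = -1) : 2 ≤ monoPairs F 9 := by
  have := le_monoPairs_of_psdCheck (q := 3) (al := 3016) (be := 1284) (by decide +kernel) hF
  change _ ≤ 4000 * (monoPairs F 9 : ℤ) at this
  push_cast at this
  omega

theorem seven_le_monoPairs {F : ℕ → ℤ} (hF : ∀ i, F i = 1 ∨ F i = -1) : 7 ≤ monoPairs F 18 := by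
  have := le_monoPairs_of_psdCheck (q := 6) (al := 6032) (be := 1705) (by decide +kernel) hF
  change _ ≤ 4000 * (monoPairs F 18 : ℤ) at this
  push_cast at this
  omega

theorem nineteen_le_monoPairs {F : ℕ → ℤ} (hF : ∀ i, F i = 1 ∨ F i = -1) :
    19 ≤ monoPairs F 33 := by
  have := le_monoPairs_of_psdCheck (q := 11) (al := 11225) (be := 3966) (by decide +kernel) hF
  change _ ≤ 4000 * (monoPairs F 33 : ℤ) at this
  push_cast at this
  omega

theorem fifty_three_le_monoPairs {F : ℕ → ℤ} (hF : ∀ i, F i = 1 ∨ F i = -1) :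
    53 ≤ monoPairs F 54 := by
  have := le_monoPairs_of_psdCheck (q := 18) (al := 18090) (be := 6200) (by decide +kernel) hF
  change _ ≤ 4000 * (monoPairs F 54 : ℤ) at this
  push_cast at this
  omega

theorem psdCheck_blockMatrix_ten :
    psdCheck (3 * 10) (triRows (blockMatrix 10) 0 (3 * 10)) = true := by
  decide +kernel

theorem psdCheck_blockMatrix_twelve :
    psdCheck (3 * 12) (triRows (blockMatrix 12) 0 (3 * 12)) = true := by
  decide +kernel

theorem psdCheck_blockMatrix_sixteen :
    psdCheck (3 * 16) (triRows (blockMatrix 16) 0 (3 * 16)) = true := by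
  decide +kernel

/-- On each range the count is bounded at a point not beyond its left end and compared with `n²` at
its right end. The tightest range ends at 121, where `28800 * 85 / 121²` is just above 167. -/
theorem mul_sq_le_monoPairs {F : ℕ → ℤ} (hF : ∀ i, F i = 1 ∨ F i = -1) {n : ℕ} (hn : 9 ≤ n) :
    167 * n ^ 2 ≤ 28800 * monoPairs F n := by
  have step : ∀ {k N c : ℕ}, k ≤ n → n ≤ N → c ≤ monoPairs F k → 167 * N ^ 2 ≤ 28800 * c →
      167 * n ^ 2 ≤ 28800 * monoPairs F n := by
    intro k N c hk hN hc h
    calc 167 * n ^ 2 ≤ 167 * N ^ 2 := by gcongr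
      _ ≤ 28800 * c := h
      _ ≤ 28800 * monoPairs F n := by
        have := monoPairs_mono F hk
        omega
  rcases le_or_gt n 18 with h | h
  · exact step hn h (two_le_monoPairs hF) (by norm_num)
  rcases le_or_gt n 34 with h' | h'
  · exact step h.le h' (seven_le_monoPairs hF) (by norm_num)
  rcases le_or_gt n 57 with h' | h'
  · exact step (by omega : 33 ≤ n) h' (nineteen_le_monoPairs hF) (by norm_num)
  rcases le_or_gt n 95 with h' | h'
  · exact step (by omega : 54 ≤ n) h' (fifty_three_le_monoPairs hF) (by norm_num)
  rcases le_or_gt n 121 with h' | h'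
  · refine step (by omega : 90 ≤ n) h' (c := 85) ?_ (by norm_num)
    have := le_monoPairs_of_blockMatrix psdCheck_blockMatrix_ten 1 hF
    change _ ≤ 4 * (monoPairs F 90 : ℤ) at this
    push_cast at this
    omega
  rcases le_or_gt n 157 with h' | h'
  · refine step (by omega : 108 ≤ n) h' (c := 144) ?_ (by norm_num)
    have := le_monoPairs_of_blockMatrix psdCheck_blockMatrix_twelve 1 hF
    change _ ≤ 4 * (monoPairs F 108 : ℤ) at this
    push_cast at this
    omega
  rcases le_or_gt n 228 with h' | h'
  · refine step (by omega : 144 ≤ n) h' (c := 304) ?_ (by norm_num)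
    have := le_monoPairs_of_blockMatrix psdCheck_blockMatrix_sixteen 1 hF
    change _ ≤ 4 * (monoPairs F 144 : ℤ) at this
    push_cast at this
    omega
  -- Here `108 = 9 * 12`. The final inequality `167 (108 t + 107)² ≤ 7200 (684 t² - 108 t)` holds
  -- from `t = 2` on but fails at `t = 1`.
  obtain ⟨t, ht, h1, h2⟩ : ∃ t, 2 ≤ t ∧ 108 * t ≤ n ∧ n ≤ 108 * t + 107 :=
    ⟨n / 108, by omega, by omega, by omega⟩
  have h3 := le_monoPairs_of_blockMatrix psdCheck_blockMatrix_twelve t hF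
  have h4 := monoPairs_mono F h1
  norm_num at h3
  have h5 : (n : ℤ) ^ 2 ≤ (108 * t + 107) ^ 2 := pow_le_pow_left₀ (by positivity) (by omega) 2
  zify at h4 ht ⊢
  nlinarith

/-! ### Transfer to 2-colourings of `[n]`, and the bound 9 for the Rado number. -/

namespace LinearEquation

/-- The colouring of positions by signs that extends a `2`-colouring of `[n]`. -/
def Coloring.sign {n : ℕ} (χ : Coloring n 2) (i : ℕ) : ℤ :=
  if h : i + 1 ∈ Finset.Icc 1 n then (if χ ⟨i + 1, h⟩ = 0 then 1 else -1) else 1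

theorem Coloring.sign_eq_or {n : ℕ} (χ : Coloring n 2) (i : ℕ) : χ.sign i = 1 ∨ χ.sign i = -1 := by
  unfold Coloring.sign
  split_ifs <;> simp

theorem Coloring.eq_of_sign_eq {n : ℕ} (χ : Coloring n 2) {i j : ℕ} (hi : i + 1 ∈ Finset.Icc 1 n)
    (hj : j + 1 ∈ Finset.Icc 1 n) (h : χ.sign i = χ.sign j) : χ ⟨i + 1, hi⟩ = χ ⟨j + 1, hj⟩ := by
  simp only [Coloring.sign, dif_pos hi, dif_pos hj] at h
  split_ifs at h <;> omega

/-- The first two entries determine the third, which stays in range because `(i + j) / 3 < n`. So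
the default sign outside `[n]` never enters. -/
theorem monoPairs_sign_le {n : ℕ} (χ : Coloring n 2) :
    monoPairs χ.sign n ≤ eqXAddYEqThreeZ.monoCount χ := by
  have hmem : ∀ i, i < n → i + 1 ∈ Finset.Icc 1 n := fun i hi => Finset.mem_Icc.2 (by omega)
  refine (Finset.card_le_card fun p hp => ?_).trans (Finset.card_image_le
    (f := fun q : ↥(Finset.Icc 1 n) × ↥(Finset.Icc 1 n) × ↥(Finset.Icc 1 n) =>
      ((q.1 : ℕ) - 1, (q.2.1 : ℕ) - 1)))
  simp only [Finset.mem_filter, Finset.mem_product, Finset.mem_range] at hp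
  obtain ⟨⟨h1, h2⟩, h3, h4, h5⟩ := hp
  have h6 : (p.1 + p.2) / 3 < n := by omega
  refine Finset.mem_image.2 ⟨(⟨p.1 + 1, hmem _ h1⟩, ⟨p.2 + 1, hmem _ h2⟩,
    ⟨(p.1 + p.2) / 3 + 1, hmem _ h6⟩), ?_, rfl⟩
  refine Finset.mem_filter.2 ⟨Finset.mem_univ _, ?_, χ.eq_of_sign_eq _ _ h4,
    χ.eq_of_sign_eq _ _ h5⟩
  simp only [IsSolution, eqXAddYEqThreeZ]
  omega

theorem mul_sq_le_monoCount {n : ℕ} (hn : 9 ≤ n) (χ : Coloring n 2) :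
    167 * n ^ 2 ≤ 28800 * eqXAddYEqThreeZ.monoCount χ :=
  (mul_sq_le_monoPairs χ.sign_eq_or hn).trans (Nat.mul_le_mul_left _ (monoPairs_sign_le χ))

theorem exists_isMonoSolution {n : ℕ} (hn : 9 ≤ n) (χ : Coloring n 2) :
    ∃ x y z, eqXAddYEqThreeZ.IsMonoSolution χ x y z := by
  have h := mul_sq_le_monoCount hn χ
  have h0 : 0 < eqXAddYEqThreeZ.monoCount χ := by nlinarith
  obtain ⟨p, hp⟩ := Finset.card_pos.1 h0
  exact ⟨_, _, _, (Finset.mem_filter.1 hp).2⟩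

theorem exists_coloring_forall_not_isMonoSolution {n : ℕ} (hn : n ≤ 8) :
    ∃ χ : Coloring n 2, ∀ x y z, ¬ eqXAddYEqThreeZ.IsMonoSolution χ x y z := by
  let c : ℕ → Fin 2 := fun x => if x ∈ [2, 5, 6, 8] then 0 else 1
  have key : ∀ x y z : Fin 9, ¬ (1 ≤ x.1 ∧ 1 ≤ y.1 ∧ 1 ≤ z.1 ∧ x.1 + y.1 = 3 * z.1 ∧
      c x = c y ∧ c y = c z) := by
    decide
  refine ⟨fun x => c x, fun x y z ⟨h, hxyz⟩ => ?_⟩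
  have hx := Finset.mem_Icc.1 x.2
  have hy := Finset.mem_Icc.1 y.2
  have hz := Finset.mem_Icc.1 z.2
  simp only [IsSolution, eqXAddYEqThreeZ] at h
  have hsum : (x : ℕ) + y = 3 * z := by omega
  exact key ⟨x, by omega⟩ ⟨y, by omega⟩ ⟨z, by omega⟩ ⟨hx.1, hy.1, hz.1, hsum, hxyz⟩

theorem nine_le_radoNumber : 9 ≤ eqXAddYEqThreeZ.radoNumber 2 := by
  -- Nonemptiness is essential: the infimum of an empty set of naturals is 0. It comes from the
  -- counting bound at `n = 9`, which forces a solution.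
  have hne : {N : ℕ | ∀ χ : Coloring N 2, ∃ x y z,
      eqXAddYEqThreeZ.IsMonoSolution χ x y z}.Nonempty := ⟨9, exists_isMonoSolution le_rfl⟩
  refine le_csInf hne fun N hN => ?_
  by_contra! h
  obtain ⟨χ, hχ⟩ := exists_coloring_forall_not_isMonoSolution (n := N) (by omega)
  obtain ⟨x, y, z, hxyz⟩ := hN χ
  exact hχ x y z hxyz

end LinearEquation

theorem theorem6 (n : ℕ) (hn : eqXAddYEqThreeZ.radoNumber 2 ≤ n) :
    (167 * (n : ℝ) ^ 2 / 28800 : ℝ) ≤ (eqXAddYEqThreeZ.minMonoCount n 2 : ℝ) := by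
  have hn9 := LinearEquation.nine_le_radoNumber.trans hn
  obtain ⟨χ, hχ⟩ := Nat.sInf_mem (Set.range_nonempty
    fun χ : LinearEquation.Coloring n 2 => eqXAddYEqThreeZ.monoCount χ)
  have h := LinearEquation.mul_sq_le_monoCount hn9 χ
  rw [LinearEquation.minMonoCount, iInf, ← hχ, div_le_iff₀ (by norm_num), mul_comm _ (28800 : ℝ)]
  exact_mod_cast h
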